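/- Let $M$ be a connected complex manifold with complex structure $J$, and assume that $M$ has complex dimension at least $2$ or is compact. An lcK structure on $M$ is a pair $(g_0,\theta_0)$ of a Hermitian metric $g_0$, with fundamental form $\Omega_0=g_0(J\cdot,\cdot)$, and a closed $1$-form $\theta_0$ (the Lee form) such that $\mathrm{d}\Omega_0=\theta_0\wedge\Omega_0$; its Lee vector field $T_0$ is the $g_0$-dual of $\theta_0$. It is a normalized Vaisman structure if $T_0$ is a Killing vector field of $g_0$ and $|T_0|_{g_0}=1$ everywhere. Let $(g_0,\theta_0)$ be a normalized Vaisman structure on $M$, and let $K$ be a (real, smooth) vector field on $M$ which is holomorphic ($\mathcal{L}_KJ=0$) and Killing ($\mathcal{L}_Kg_0=0$). Then there are a real constant $c$, a smooth function $a\colon M\to\mathbb{R}$ (called the Hamiltonian of $K$) and a smooth vector field $K_0$ on $M$, everywhere $g_0$-orthogonal to $T_0$ and $JT_0$, such that $$K=cT_0+aJT_0+K_0,\qquad K_0\lrcorner\Omega_0=\mathrm{d}a,\qquad T_0(a)=JT_0(a)=0.$$ -/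

import Mathlib

open scoped Manifold ContDiff

namespace LcK

noncomputable section

section RealStructure

/-- A holomorphic atlas is in particular a real analytic atlas, so a complex manifold has an
underlying real manifold, modelled on the same space `E` seen as a real vector space. -/
instance isManifold_real {E : Type*} [NormedAddCommGroup E] [NormedSpace ℂ E]
    {M : Type*} [TopologicalSpace M] [ChartedSpace E M] [h : IsManifold 𝓘(ℂ, E) ω M] :
    IsManifold 𝓘(ℝ, E) ω M := by
  apply isManifold_of_contDiffOn
  intro e e' he he'
  have h1 := (contDiffGroupoid ω 𝓘(ℂ, E)).compatible he he'
  rw [contDiffGroupoid, mem_groupoid_of_pregroupoid] at h1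
  exact ContDiffOn.restrict_scalars ℝ h1.1

end RealStructure

section Basic

variable {E : Type*} [NormedAddCommGroup E] [NormedSpace ℂ E]
  {M : Type*} [TopologicalSpace M] [ChartedSpace E M]

variable (E M) in
/-- Real vector fields on `M` (not necessarily smooth). -/
abbrev VectorFields : Type _ := ∀ x : M, TangentSpace 𝓘(ℝ, E) x

variable (E M) in
/-- Real `1`-forms on `M` (not necessarily smooth). -/
abbrev OneForms : Type _ := ∀ x : M, TangentSpace 𝓘(ℝ, E) x →L[ℝ] Bundle.Trivial M ℝ x

variable (E M) in
/-- Fields of real bilinear forms on `M` (not necessarily smooth or antisymmetric). -/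
abbrev BilinearForms : Type _ :=
  ∀ x : M, TangentSpace 𝓘(ℝ, E) x →L[ℝ] TangentSpace 𝓘(ℝ, E) x →L[ℝ] ℝ

/-- The complex structure `J` on the tangent space of a complex manifold at `x`: multiplication
by `i` in a holomorphic chart around `x` (`TangentSpace 𝓘(ℝ, E) x` is the model space `E`,
through the differential of the preferred chart at `x`). -/
def J (x : M) : TangentSpace 𝓘(ℝ, E) x →L[ℝ] TangentSpace 𝓘(ℝ, E) x :=
  ((Complex.I • ContinuousLinearMap.id ℂ E).restrictScalars ℝ : E →L[ℝ] E)

/-- The vector field `J X`. -/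
def JField (X : VectorFields E M) : VectorFields E M := fun x => J x (X x)

/-- The derivative `X(f)` of a function `f` along a vector field `X`. -/
def lieD (X : VectorFields E M) (f : M → ℝ) : M → ℝ :=
  fun x => mvfderiv 𝓘(ℝ, E) f x (X x)

/-- The Lie bracket of vector fields. -/
def bracket (X Y : VectorFields E M) : VectorFields E M :=
  VectorField.mlieBracket 𝓘(ℝ, E) X Y

/-- The exterior derivative of a `1`-form,
`dα(X, Y) = X(α(Y)) - Y(α(X)) - α([X, Y])`. -/
def dOne (α : OneForms E M) (X Y : VectorFields E M) (x : M) : ℝ :=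
  lieD X (fun y => α y (Y y)) x - lieD Y (fun y => α y (X y)) x - α x (bracket X Y x)

/-- The exterior derivative of a `2`-form,
`dω(X, Y, Z) = X(ω(Y, Z)) - Y(ω(X, Z)) + Z(ω(X, Y))
  - ω([X, Y], Z) + ω([X, Z], Y) - ω([Y, Z], X)`. -/
def dTwo (w : BilinearForms E M) (X Y Z : VectorFields E M) (x : M) : ℝ :=
  lieD X (fun y => w y (Y y) (Z y)) x - lieD Y (fun y => w y (X y) (Z y)) x
    + lieD Z (fun y => w y (X y) (Y y)) x
    - w x (bracket X Y x) (Z x) + w x (bracket X Z x) (Y x) - w x (bracket Y Z x) (X x)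

/-- The wedge product of a `1`-form and a `2`-form, evaluated on three tangent vectors. -/
def wedgeOneTwo (α : OneForms E M) (w : BilinearForms E M) (x : M)
    (u v z : TangentSpace 𝓘(ℝ, E) x) : ℝ :=
  α x u * w x v z + α x v * w x z u + α x z * w x u v

end Basic

section Smooth

variable {E : Type*} [NormedAddCommGroup E] [NormedSpace ℂ E]
  {M : Type*} [TopologicalSpace M] [ChartedSpace E M] [IsManifold 𝓘(ℂ, E) ω M]

/-- Smoothness of a vector field, as a section of the tangent bundle. -/
def SmoothField (X : VectorFields E M) : Prop :=
  ContMDiff 𝓘(ℝ, E) (𝓘(ℝ, E).prod 𝓘(ℝ, E)) ∞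
    (fun x => Bundle.TotalSpace.mk' E (E := fun y : M => TangentSpace 𝓘(ℝ, E) y) x (X x))

/-- Smoothness of a `1`-form, as a section of the cotangent bundle. -/
def SmoothOneForm (α : OneForms E M) : Prop :=
  ContMDiff 𝓘(ℝ, E) (𝓘(ℝ, E).prod 𝓘(ℝ, E →L[ℝ] ℝ)) ∞
    (fun x => Bundle.TotalSpace.mk' (E →L[ℝ] ℝ)
      (E := fun y : M => TangentSpace 𝓘(ℝ, E) y →L[ℝ] Bundle.Trivial M ℝ y) x (α x))

variable (E M) in
/-- Smooth Riemannian metrics on (the real manifold underlying) `M`. -/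
abbrev Metric : Type _ :=
  Bundle.ContMDiffRiemannianMetric 𝓘(ℝ, E) ∞ E (fun x : M => TangentSpace 𝓘(ℝ, E) x)

/-- A Hermitian metric: `g(Ju, Jv) = g(u, v)`. -/
def IsHermitian (g : Metric E M) : Prop :=
  ∀ (x : M) (u v : TangentSpace 𝓘(ℝ, E) x), g.inner x (J x u) (J x v) = g.inner x u v

/-- The fundamental form `Ω = g(J·, ·)`. -/
def fundamentalForm (g : Metric E M) : BilinearForms E M := fun x => (g.inner x).comp (J x)

/-- A Killing vector field: a smooth vector field `K` with `L_K g = 0`, where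
`(L_K g)(X, Y) = K(g(X, Y)) - g([K, X], Y) - g(X, [K, Y])`. -/
structure IsKilling (g : Metric E M) (K : VectorFields E M) : Prop where
  smooth : SmoothField K
  lie_metric : ∀ X Y : VectorFields E M, SmoothField X → SmoothField Y → ∀ x : M,
    lieD K (fun y => g.inner y (X y) (Y y)) x
      - g.inner x (bracket K X x) (Y x) - g.inner x (X x) (bracket K Y x) = 0

/-- A (real) holomorphic vector field: a smooth vector field `K` with `L_K J = 0`, where
`(L_K J)(X) = [K, JX] - J[K, X]`. -/
structure IsHolomorphicField (K : VectorFields E M) : Prop where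
  smooth : SmoothField K
  lie_complex : ∀ X : VectorFields E M, SmoothField X → ∀ x : M,
    bracket K (JField X) x = J x (bracket K X x)

variable (E M) in
/-- A locally conformally Kähler structure on the complex manifold `M`: a Hermitian metric `g`
and a closed `1`-form `θ`, the Lee form, with `dΩ = θ ∧ Ω`. -/
structure LcKStructure where
  g : Metric E M
  θ : OneForms E M
  hermitian : IsHermitian g
  smooth_θ : SmoothOneForm θ
  closed_θ : ∀ X Y : VectorFields E M, SmoothField X → SmoothField Y → ∀ x : M,
    dOne θ X Y x = 0
  d_fundamentalForm : ∀ X Y Z : VectorFields E M,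
    SmoothField X → SmoothField Y → SmoothField Z → ∀ x : M,
      dTwo (fundamentalForm g) X Y Z x = wedgeOneTwo θ (fundamentalForm g) x (X x) (Y x) (Z x)

end Smooth

section Lee

variable {E : Type*} [NormedAddCommGroup E] [NormedSpace ℂ E] [FiniteDimensional ℂ E]
  {M : Type*} [TopologicalSpace M] [ChartedSpace E M] [IsManifold 𝓘(ℂ, E) ω M]

theorem exists_metricDual (g : Metric E M) (α : OneForms E M) (x : M) :
    ∃ t : TangentSpace 𝓘(ℝ, E) x, ∀ v : TangentSpace 𝓘(ℝ, E) x, g.inner x t v = α x v := by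
  have : FiniteDimensional ℝ (TangentSpace 𝓘(ℝ, E) x) :=
    inferInstanceAs (FiniteDimensional ℝ E)
  let B : LinearMap.BilinForm ℝ (TangentSpace 𝓘(ℝ, E) x) :=
    LinearMap.mk₂ ℝ (fun u v => g.inner x u v) (by simp) (by simp) (by simp) (by simp)
  have hB : Function.Injective B := by
    rw [← LinearMap.ker_eq_bot, LinearMap.ker_eq_bot']
    intro u hu
    by_contra h
    have h1 := g.pos x u h
    have h2 : B u u = 0 := by rw [hu]; rfl
    exact absurd h2 h1.ne'
  have hs : Function.Surjective B :=
    (LinearMap.injective_iff_surjective_of_finrank_eq_finrank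
      (Subspace.dual_finrank_eq (K := ℝ) (V := TangentSpace 𝓘(ℝ, E) x)).symm).1 hB
  obtain ⟨t, ht⟩ := hs ((α x : TangentSpace 𝓘(ℝ, E) x →L[ℝ] ℝ) : _ →ₗ[ℝ] ℝ)
  exact ⟨t, fun v => LinearMap.congr_fun ht v⟩

/-- The vector field which is dual to the `1`-form `α` with respect to the metric `g`. -/
def metricDual (g : Metric E M) (α : OneForms E M) : VectorFields E M :=
  fun x => (exists_metricDual g α x).choose

theorem metricDual_spec (g : Metric E M) (α : OneForms E M) (x : M)
    (v : TangentSpace 𝓘(ℝ, E) x) : g.inner x (metricDual g α x) v = α x v :=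
  (exists_metricDual g α x).choose_spec v

/-- The fundamental form of an lcK structure. -/
def LcKStructure.Ω (S : LcKStructure E M) : BilinearForms E M := fundamentalForm S.g

/-- The Lee vector field: the metric dual of the Lee form. -/
def LcKStructure.T (S : LcKStructure E M) : VectorFields E M := metricDual S.g S.θ

/-- The lcK structure is Vaisman: its Lee vector field is Killing and non-zero. -/
def LcKStructure.IsVaisman (S : LcKStructure E M) : Prop := IsKilling S.g S.T ∧ S.T ≠ 0

/-- The Lee vector field (equivalently, the Lee form) has norm `1`. -/
def LcKStructure.IsNormalized (S : LcKStructure E M) : Prop :=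
  ∀ x : M, S.g.inner x (S.T x) (S.T x) = 1

end Lee

end

end LcK

namespace LcK

open Set
open scoped Topology

noncomputable section

/-! ### Real and complex charts, brackets in coordinates, integrability of `J` -/

section Charts

variable {E : Type*} [NormedAddCommGroup E] [NormedSpace ℂ E]
  {M : Type*} [TopologicalSpace M] [ChartedSpace E M] [IsManifold 𝓘(ℂ, E) ω M]

/-! Write T, θ for the Lee field and form, η = g(JT, ·) and Ω = g(J·, ·). The constant is c = θ(K),
the Hamiltonian is a = η(K), and K₀ is what remains of K; orthogonality is then immediate.

Since T is Killing, Cartan's formula gives g((L_T J)·, ·) = L_T Ω = dη + Ω - θ∧η. The right side is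
J-invariant (for dη by dθ = 0 and integrability of J), while the left side changes sign under J.
Both vanish: T is holomorphic (`bracket_T_JField`) and dη = θ∧η - Ω (`dEta_eq`). As K preserves g
and J, Cartan's formula also gives d(θ(K)) = L_K θ = g([K, T], ·) (`inner_bracket_T`) and da = L_K η
- K⌟dη (`lieD_hamiltonian`). Once θ(K) is constant, [K, T] = 0, so L_K η = 0 and da = K₀⌟Ω; the
vanishing of T(a) and JT(a) follows from orthogonality.

It remains to see that f = θ(K) is constant. Applying L_K to dΩ = θ∧Ω, with L_K Ω = 0, gives df∧Ω =
0 (`lieD_wedge`), which forces df = 0 in complex dimension at least 2. In dimension 1 with M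
compact, a and f satisfy Cauchy–Riemann equations and T(f) = 0; then JT(f) is constant, and it
vanishes where f is maximal. -/

theorem tangentCoordChange_I_smul {x y z : M} (hx : z ∈ (chartAt E x).source)
    (hy : z ∈ (chartAt E y).source) (v : E) :
    tangentCoordChange 𝓘(ℝ, E) x y z (Complex.I • v)
      = Complex.I • tangentCoordChange 𝓘(ℝ, E) x y z v := by
  have hz : z ∈ (extChartAt 𝓘(ℂ, E) x).source ∩ (extChartAt 𝓘(ℂ, E) y).source := by
    simpa only [extChartAt_source] using ⟨hx, hy⟩
  have hz' : z ∈ (extChartAt 𝓘(ℝ, E) x).source ∩ (extChartAt 𝓘(ℝ, E) y).source := by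
    simpa only [extChartAt_source] using ⟨hx, hy⟩
  have h1 := (hasFDerivWithinAt_tangentCoordChange (I := 𝓘(ℂ, E)) hz).restrictScalars ℝ
  have h2 := hasFDerivWithinAt_tangentCoordChange (I := 𝓘(ℝ, E)) hz'
  -- Both maps are real derivatives of the same holomorphic change of charts, hence equal by
  -- uniqueness; the complex one commutes with `I`.
  have h3 : (tangentCoordChange 𝓘(ℂ, E) x y z).restrictScalars ℝ
      = tangentCoordChange 𝓘(ℝ, E) x y z := by
    have hr : range 𝓘(ℝ, E) = univ := by simp
    have hr' : range 𝓘(ℂ, E) = univ := by simp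
    rw [hr] at h2
    rw [hr'] at h1
    rw [hasFDerivWithinAt_univ] at h1 h2
    exact h1.unique h2
  rw [← h3]
  simp

theorem smoothField_JField {X : VectorFields E M} (hX : SmoothField X) :
    SmoothField (JField X) := by
  intro x₀
  have h := hX x₀
  rw [Bundle.contMDiffAt_section] at h ⊢
  have h2 : ContMDiffAt 𝓘(ℝ, E) 𝓘(ℝ, E) ∞ (fun x => Complex.I •
      ((trivializationAt E (TangentSpace 𝓘(ℝ, E)) x₀) ⟨x, X x⟩).2) x₀ :=
    ContMDiffAt.comp x₀
      ((Complex.I • ContinuousLinearMap.id ℂ E).restrictScalars ℝ).contDiff.contDiffAt.contMDiffAt h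
  refine h2.congr_of_eventuallyEq ?_
  filter_upwards [(chartAt E x₀).open_source.mem_nhds (mem_chart_source E x₀)] with x hx
  exact tangentCoordChange_I_smul (mem_chart_source E x) hx (X x)

/-- The coordinate expression of a vector field in the preferred chart at `x₀`. -/
def inChart (x₀ : M) (X : VectorFields E M) (y : E) : E :=
  tangentCoordChange 𝓘(ℝ, E) ((extChartAt 𝓘(ℝ, E) x₀).symm y) x₀
    ((extChartAt 𝓘(ℝ, E) x₀).symm y) (X ((extChartAt 𝓘(ℝ, E) x₀).symm y))

theorem mpullbackWithin_eq_inChart (x₀ : M) (X : VectorFields E M) {y : E}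
    (hy : y ∈ (extChartAt 𝓘(ℝ, E) x₀).target) :
    VectorField.mpullbackWithin 𝓘(ℝ, E) 𝓘(ℝ, E) (extChartAt 𝓘(ℝ, E) x₀).symm X
      (range 𝓘(ℝ, E)) y = inChart x₀ X y := by
  have hs : (extChartAt 𝓘(ℝ, E) x₀).symm y ∈ (chartAt E x₀).source := by
    simpa only [extChartAt_source] using (extChartAt 𝓘(ℝ, E) x₀).map_target hy
  have : IsManifold 𝓘(ℝ, E) 1 M := IsManifold.of_le (n := ω) le_top
  rw [VectorField.mpullbackWithin_apply, ContinuousLinearMap.inverse_eq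
    (mfderivWithin_extChartAt_symm_comp_mfderiv_extChartAt hy)
    (mfderiv_extChartAt_comp_mfderivWithin_extChartAt_symm hy)]
  have := mfderiv_chartAt_eq_tangentCoordChange (I := 𝓘(ℝ, E)) hs
  exact congrArg (fun (L : E →L[ℝ] E) => L (X ((extChartAt 𝓘(ℝ, E) x₀).symm y))) this

theorem bracket_eq_lieBracket (X Y : VectorFields E M) (x₀ : M) :
    bracket X Y x₀ = VectorField.lieBracket ℝ (inChart x₀ X) (inChart x₀ Y)
      (extChartAt 𝓘(ℝ, E) x₀ x₀) := by
  have : IsManifold 𝓘(ℝ, E) 1 M := IsManifold.of_le (n := ω) le_top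
  -- The preferred chart at `x₀` is the one identifying the tangent space at `x₀` with `E`, so its
  -- differential there is the identity.
  have hinv : (mfderiv 𝓘(ℝ, E) 𝓘(ℝ, E) (extChartAt 𝓘(ℝ, E) x₀) x₀).inverse
      = ContinuousLinearMap.id ℝ E := by
    rw [mfderiv_extChartAt_self]
    exact ContinuousLinearMap.inverse_id
  have hev : ∀ Z : VectorFields E M,
      (VectorField.mpullbackWithin 𝓘(ℝ, E) 𝓘(ℝ, E) (extChartAt 𝓘(ℝ, E) x₀).symm Z
        (range 𝓘(ℝ, E)) : E → E) =ᶠ[𝓝 (extChartAt 𝓘(ℝ, E) x₀ x₀)] inChart x₀ Z := by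
    intro Z
    filter_upwards [extChartAt_target_mem_nhds (I := 𝓘(ℝ, E)) x₀] with y hy
    exact mpullbackWithin_eq_inChart x₀ Z hy
  refine Eq.trans ?_ ((hev X).lieBracket_vectorField_eq (hev Y))
  rw [bracket, VectorField.mlieBracket, VectorField.mlieBracketWithin_apply, hinv]
  simp only [preimage_univ, univ_inter, ModelWithCorners.range_eq_univ]
  exact congrFun (VectorField.lieBracketWithin_univ (𝕜 := ℝ) (E := E)) _

theorem differentiableAt_inChart [CompleteSpace E] {X : VectorFields E M}
    (hX : SmoothField X) (x₀ : M) :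
    DifferentiableAt ℝ (inChart x₀ X) (extChartAt 𝓘(ℝ, E) x₀ x₀) := by
  have : IsManifold 𝓘(ℝ, E) 2 M := IsManifold.of_le (n := ω) le_top
  have h := ((hX x₀).mdifferentiableAt (by simp)).mdifferentiableWithinAt (s := univ)
    |>.differentiableWithinAt_mpullbackWithin_vectorField
  simp only [preimage_univ, univ_inter] at h
  rw [ModelWithCorners.range_eq_univ] at h
  have h' : DifferentiableAt ℝ (VectorField.mpullbackWithin 𝓘(ℝ, E) 𝓘(ℝ, E)
      (extChartAt 𝓘(ℝ, E) x₀).symm X univ : E → E) (extChartAt 𝓘(ℝ, E) x₀ x₀) :=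
    differentiableWithinAt_univ.1 h
  refine h'.congr_of_eventuallyEq ?_
  filter_upwards [extChartAt_target_mem_nhds (I := 𝓘(ℝ, E)) x₀] with y hy
  rw [← mpullbackWithin_eq_inChart x₀ X hy, ModelWithCorners.range_eq_univ]

theorem inChart_JField (X : VectorFields E M) (x₀ : M) :
    inChart x₀ (JField X) =ᶠ[𝓝 (extChartAt 𝓘(ℝ, E) x₀ x₀)]
      fun y => Complex.I • inChart x₀ X y := by
  filter_upwards [extChartAt_target_mem_nhds (I := 𝓘(ℝ, E)) x₀] with y hy
  have hs : (extChartAt 𝓘(ℝ, E) x₀).symm y ∈ (chartAt E x₀).source := by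
    simpa only [extChartAt_source] using (extChartAt 𝓘(ℝ, E) x₀).map_target hy
  exact tangentCoordChange_I_smul (mem_chart_source E _) hs _

/-- The Nijenhuis tensor of a complex manifold vanishes. -/
theorem nijenhuis_eq_zero [CompleteSpace E] {X Y : VectorFields E M}
    (hX : SmoothField X) (hY : SmoothField Y) (x : M) :
    bracket (JField X) (JField Y) x
      = bracket X Y x + J x (bracket (JField X) Y x) + J x (bracket X (JField Y) x) := by
  have dX := differentiableAt_inChart hX x
  have dY := differentiableAt_inChart hY x
  -- In a holomorphic chart `J` has constant coefficients, so it passes through derivatives.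
  have hI : ∀ (f : E → E) (z v : E), DifferentiableAt ℝ f z →
      fderiv ℝ (fun y => Complex.I • f y) z v = Complex.I • fderiv ℝ f z v := by
    intro f z v hf
    rw [fderiv_fun_const_smul hf]
    rfl
  simp only [bracket_eq_lieBracket]
  rw [(inChart_JField X x).lieBracket_vectorField_eq (inChart_JField Y x),
    (inChart_JField X x).lieBracket_vectorField_eq (Filter.EventuallyEq.refl _ (inChart x Y)),
    (Filter.EventuallyEq.refl _ (inChart x X)).lieBracket_vectorField_eq (inChart_JField Y x)]
  set p := extChartAt 𝓘(ℝ, E) x x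
  change VectorField.lieBracket ℝ (fun y => Complex.I • inChart x X y)
      (fun y => Complex.I • inChart x Y y) p
    = (VectorField.lieBracket ℝ (inChart x X) (inChart x Y) p : E)
    + (Complex.I •
        VectorField.lieBracket ℝ (fun y => Complex.I • inChart x X y) (inChart x Y) p : E)
    + (Complex.I •
        VectorField.lieBracket ℝ (inChart x X) (fun y => Complex.I • inChart x Y y) p : E)
  simp only [VectorField.lieBracket, hI _ _ _ dX, hI _ _ _ dY]
  simp only [smul_sub, smul_smul, Complex.I_mul_I, neg_smul, one_smul]
  abel

end Charts

/-! ### Calculus of smooth vector fields -/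

section Fields

variable {E : Type*} [NormedAddCommGroup E] [NormedSpace ℂ E]
  {M : Type*} [TopologicalSpace M] [ChartedSpace E M] [IsManifold 𝓘(ℂ, E) ω M]

theorem SmoothField.mdifferentiableAt {X : VectorFields E M} (hX : SmoothField X) (x : M) :
    MDifferentiableAt 𝓘(ℝ, E) (𝓘(ℝ, E).prod 𝓘(ℝ, E))
      (fun x => (⟨x, X x⟩ : TangentBundle 𝓘(ℝ, E) M)) x :=
  (hX x).mdifferentiableAt (by simp)

theorem smoothField_bracket [CompleteSpace E] {X Y : VectorFields E M} (hX : SmoothField X)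
    (hY : SmoothField Y) : SmoothField (bracket X Y) := by
  have : IsManifold 𝓘(ℝ, E) ((⊤ : ℕ∞) + 1) M := IsManifold.of_le (n := ω) le_top
  exact ContDiff.mlieBracket_vectorField (n := ⊤) (m := ⊤) hX hY (by simp)

theorem smoothField_smul {f : M → ℝ} {X : VectorFields E M}
    (hf : ContMDiff 𝓘(ℝ, E) 𝓘(ℝ, ℝ) ∞ f) (hX : SmoothField X) : SmoothField (f • X) :=
  have : IsManifold 𝓘(ℝ, E) (∞ + 1) M := IsManifold.of_le (n := ω) le_top
  have := TangentBundle.contMDiffVectorBundle (I := 𝓘(ℝ, E)) (M := M) (n := ∞)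
  hf.smul_section hX

theorem smoothField_add {X Y : VectorFields E M}
    (hX : SmoothField X) (hY : SmoothField Y) : SmoothField (X + Y) :=
  have : IsManifold 𝓘(ℝ, E) (∞ + 1) M := IsManifold.of_le (n := ω) le_top
  have := TangentBundle.contMDiffVectorBundle (I := 𝓘(ℝ, E)) (M := M) (n := ∞)
  hX.add_section hY

theorem smooth_metric_apply (g : Metric E M) {X Y : VectorFields E M}
    (hX : SmoothField X) (hY : SmoothField Y) :
    ContMDiff 𝓘(ℝ, E) 𝓘(ℝ, ℝ) ∞ (fun x => g.inner x (X x) (Y x)) := by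
  have h := ContMDiff.clm_bundle_apply₂ (b := id) (E₃ := Bundle.Trivial M ℝ) g.contMDiff hX hY
  intro x
  exact (Bundle.contMDiffAt_section _).1 (h x)

theorem smooth_lieD {f : M → ℝ} {X : VectorFields E M}
    (hf : ContMDiff 𝓘(ℝ, E) 𝓘(ℝ, ℝ) ∞ f) (hX : SmoothField X) :
    ContMDiff 𝓘(ℝ, E) 𝓘(ℝ, ℝ) ∞ (lieD X f) :=
  (contMDiff_snd_tangentBundle_modelSpace ℝ 𝓘(ℝ, ℝ)).comp
    ((hf.contMDiff_tangentMap (m := ∞) (by simp)).comp hX)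

theorem bracket_smul_right [CompleteSpace E] {f : M → ℝ} (X : VectorFields E M)
    {Y : VectorFields E M} (hf : ContMDiff 𝓘(ℝ, E) 𝓘(ℝ, ℝ) ∞ f) (hY : SmoothField Y) :
    bracket X (f • Y) = lieD X f • Y + f • bracket X Y := by
  have : IsManifold 𝓘(ℝ, E) 2 M := IsManifold.of_le (n := ω) le_top
  funext x
  exact VectorField.mlieBracket_smul_right ((hf x).mdifferentiableAt (by simp))
    (hY.mdifferentiableAt x)

theorem bracket_add_right [CompleteSpace E] (X : VectorFields E M)
    {Y Z : VectorFields E M} (hY : SmoothField Y) (hZ : SmoothField Z) :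
    bracket X (Y + Z) = bracket X Y + bracket X Z := by
  have : IsManifold 𝓘(ℝ, E) 2 M := IsManifold.of_le (n := ω) le_top
  funext x
  exact VectorField.mlieBracket_add_right (hY.mdifferentiableAt x) (hZ.mdifferentiableAt x)

/-- The Jacobi identity. -/
theorem bracket_bracket [CompleteSpace E] {X Y Z : VectorFields E M}
    (hX : SmoothField X) (hY : SmoothField Y) (hZ : SmoothField Z) :
    bracket X (bracket Y Z) = bracket (bracket X Y) Z + bracket Y (bracket X Z) := by
  have : IsManifold 𝓘(ℝ, E) (minSmoothness ℝ 3) M := IsManifold.of_le (n := ω) le_top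
  have h2 : minSmoothness ℝ 2 ≤ ∞ := by
    rw [minSmoothness_of_isRCLikeNormedField]
    exact WithTop.coe_le_coe.2 le_top
  exact VectorField.leibniz_identity_mlieBracket (hX.of_le h2) (hY.of_le h2) (hZ.of_le h2)

theorem lieD_bracket [CompleteSpace E] {X Y Z : VectorFields E M} {f : M → ℝ}
    (hX : SmoothField X) (hY : SmoothField Y) (hZ : SmoothField Z)
    (hf : ContMDiff 𝓘(ℝ, E) 𝓘(ℝ, ℝ) ∞ f) {x : M} (hZx : Z x ≠ 0) :
    lieD (bracket X Y) f x = lieD X (lieD Y f) x - lieD Y (lieD X f) x := by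
  have hXf := smooth_lieD hf hX
  have hYf := smooth_lieD hf hY
  have hXZ := smoothField_bracket hX hZ
  have hYZ := smoothField_bracket hY hZ
  -- Expanding the Jacobi identity for `X`, `Y`, `f • Z` by the Leibniz rule leaves the wanted
  -- identity multiplied by `Z`; this is why `Z x ≠ 0` is required.
  have h := bracket_bracket hX hY (smoothField_smul hf hZ)
  rw [bracket_smul_right _ hf hZ, bracket_smul_right _ hf hZ, bracket_smul_right _ hf hZ,
    bracket_add_right _ (smoothField_smul hYf hZ) (smoothField_smul hf hYZ),
    bracket_add_right _ (smoothField_smul hXf hZ) (smoothField_smul hf hXZ),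
    bracket_smul_right _ hYf hZ, bracket_smul_right _ hXf hZ, bracket_smul_right _ hf hYZ,
    bracket_smul_right _ hf hXZ, bracket_bracket hX hY hZ] at h
  have hx := congrFun h x
  simp only [Pi.add_apply, Pi.smul_apply', smul_add] at hx
  have h0 : (lieD (bracket X Y) f x - (lieD X (lieD Y f) x - lieD Y (lieD X f) x)) • Z x = 0 := by
    simp only [sub_smul]
    rw [← sub_eq_zero] at hx
    rw [← neg_eq_zero, ← hx]
    abel
  exact sub_eq_zero.1 ((smul_eq_zero.1 h0).resolve_right hZx)

/-- A local extension cut off by a bump function. It turns identities tested on smooth fields into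
pointwise identities on tangent vectors. -/
theorem exists_smoothField_apply_eq [FiniteDimensional ℂ E] [T2Space M] (x : M)
    (v : TangentSpace 𝓘(ℝ, E) x) :
    ∃ X : VectorFields E M, SmoothField X ∧ X x = v := by
  have : FiniteDimensional ℝ E := FiniteDimensional.complexToReal E
  have : IsManifold 𝓘(ℝ, E) (∞ + 1) M := IsManifold.of_le (n := ω) le_top
  have := TangentBundle.contMDiffVectorBundle (I := 𝓘(ℝ, E)) (M := M) (n := ∞)
  obtain ⟨s, hs, hsv⟩ := FiberBundle.exists_contMDiffOn_extend 𝓘(ℝ, E) E (k := ∞) v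
  obtain ⟨ψ, -, hψ⟩ := (SmoothBumpFunction.nhds_basis_tsupport (I := 𝓘(ℝ, E)) x).mem_iff.1
    (interior_mem_nhds.2 hs)
  have : IsManifold 𝓘(ℝ, E) ∞ M := IsManifold.of_le (n := ω) le_top
  refine ⟨(ψ : M → ℝ) • FiberBundle.extend E v, ?_, ?_⟩
  · exact ContMDiffOn.smul_section_of_tsupport ψ.contMDiff.contMDiffOn isOpen_interior hψ
      (hsv.mono interior_subset)
  · rw [Pi.smul_apply', ψ.eq_one, one_smul, FiberBundle.extend_apply_self]

end Fields

/-! ### Derivatives of functions, maxima and constancy -/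

section Functions

variable {E : Type*} [NormedAddCommGroup E] [NormedSpace ℂ E]
  {M : Type*} [TopologicalSpace M] [ChartedSpace E M]

theorem lieD_add {f g : M → ℝ} (hf : ContMDiff 𝓘(ℝ, E) 𝓘(ℝ, ℝ) ∞ f)
    (hg : ContMDiff 𝓘(ℝ, E) 𝓘(ℝ, ℝ) ∞ g) (X : VectorFields E M) (x : M) :
    lieD X (fun y => f y + g y) x = lieD X f x + lieD X g x := by
  simp only [lieD]
  rw [mvfderiv_fun_add ((hf x).mdifferentiableAt (by simp)) ((hg x).mdifferentiableAt (by simp))]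
  rfl

theorem lieD_sub {f g : M → ℝ} (hf : ContMDiff 𝓘(ℝ, E) 𝓘(ℝ, ℝ) ∞ f)
    (hg : ContMDiff 𝓘(ℝ, E) 𝓘(ℝ, ℝ) ∞ g) (X : VectorFields E M) (x : M) :
    lieD X (fun y => f y - g y) x = lieD X f x - lieD X g x := by
  simp only [lieD]
  rw [mvfderiv_fun_sub ((hf x).mdifferentiableAt (by simp)) ((hg x).mdifferentiableAt (by simp))]
  rfl

theorem lieD_mul {f g : M → ℝ} (hf : ContMDiff 𝓘(ℝ, E) 𝓘(ℝ, ℝ) ∞ f)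
    (hg : ContMDiff 𝓘(ℝ, E) 𝓘(ℝ, ℝ) ∞ g) (X : VectorFields E M) (x : M) :
    lieD X (fun y => f y * g y) x = f x * lieD X g x + g x * lieD X f x := by
  simp only [lieD]
  rw [mvfderiv_fun_mul ((hf x).mdifferentiableAt (by simp)) ((hg x).mdifferentiableAt (by simp))]
  rfl

theorem smooth_add {f g : M → ℝ} (hf : ContMDiff 𝓘(ℝ, E) 𝓘(ℝ, ℝ) ∞ f)
    (hg : ContMDiff 𝓘(ℝ, E) 𝓘(ℝ, ℝ) ∞ g) :
    ContMDiff 𝓘(ℝ, E) 𝓘(ℝ, ℝ) ∞ (fun y => f y + g y) :=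
  hf.add hg

theorem smooth_sub {f g : M → ℝ} (hf : ContMDiff 𝓘(ℝ, E) 𝓘(ℝ, ℝ) ∞ f)
    (hg : ContMDiff 𝓘(ℝ, E) 𝓘(ℝ, ℝ) ∞ g) :
    ContMDiff 𝓘(ℝ, E) 𝓘(ℝ, ℝ) ∞ (fun y => f y - g y) :=
  hf.sub hg

theorem smooth_mul {f g : M → ℝ} (hf : ContMDiff 𝓘(ℝ, E) 𝓘(ℝ, ℝ) ∞ f)
    (hg : ContMDiff 𝓘(ℝ, E) 𝓘(ℝ, ℝ) ∞ g) :
    ContMDiff 𝓘(ℝ, E) 𝓘(ℝ, ℝ) ∞ (fun y => f y * g y) :=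
  hf.mul hg

theorem lieD_neg (f : M → ℝ) (X : VectorFields E M) (x : M) :
    lieD X (fun y => -f y) x = -lieD X f x := by
  simp only [lieD]
  rw [mvfderiv_fun_neg]
  rfl

theorem lieD_const (c : ℝ) (X : VectorFields E M) (x : M) :
    lieD X (fun _ => c) x = 0 := by
  simp only [lieD]
  rw [mvfderiv_const]
  rfl

theorem mvfderiv_eq_fderiv {f : M → ℝ} {x : M} (hf : MDifferentiableAt 𝓘(ℝ, E) 𝓘(ℝ, ℝ) f x) :
    (mvfderiv 𝓘(ℝ, E) f x : E →L[ℝ] ℝ)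
      = fderiv ℝ (f ∘ (extChartAt 𝓘(ℝ, E) x).symm) (extChartAt 𝓘(ℝ, E) x x) := by
  have h := hf.mvfderiv
  rw [ModelWithCorners.range_eq_univ, fderivWithin_univ] at h
  exact h

theorem mvfderiv_eq_zero_of_isMaxOn {f : M → ℝ} {x : M}
    (hf : MDifferentiableAt 𝓘(ℝ, E) 𝓘(ℝ, ℝ) f x) (hx : IsMaxOn f univ x) :
    mvfderiv 𝓘(ℝ, E) f x = 0 := by
  refine (mvfderiv_eq_fderiv hf).trans (IsLocalMax.fderiv_eq_zero ?_)
  refine Filter.Eventually.of_forall fun y => ?_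
  simp only [Function.comp_apply, extChartAt_to_inv]
  exact hx (mem_univ _)

theorem eq_const_of_mvfderiv_eq_zero [ConnectedSpace M] [IsManifold 𝓘(ℝ, E) 1 M] {f : M → ℝ}
    (hf : ContMDiff 𝓘(ℝ, E) 𝓘(ℝ, ℝ) ∞ f) (h : ∀ x, mvfderiv 𝓘(ℝ, E) f x = 0) (x y : M) :
    f x = f y := by
  have hd : ∀ x, MDifferentiableAt 𝓘(ℝ, E) 𝓘(ℝ, ℝ) f x := fun x =>
    (hf x).mdifferentiableAt (by simp)
  have hm : ∀ x, mfderiv 𝓘(ℝ, E) 𝓘(ℝ, ℝ) f x = 0 := h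
  have hl : IsLocallyConstant f := by
    rw [IsLocallyConstant.iff_eventually_eq]
    intro x
    set φ := extChartAt 𝓘(ℝ, E) x
    have hφ : IsOpen φ.target := isOpen_extChartAt_target x
    have hD : ∀ z ∈ φ.target, HasFDerivAt (f ∘ φ.symm) (0 : E →L[ℝ] ℝ) z := by
      intro z hz
      have h1 : MDifferentiableAt 𝓘(ℝ, E) 𝓘(ℝ, E) φ.symm z :=
        ((contMDiffOn_extChartAt_symm (I := 𝓘(ℝ, E)) (n := 1) x).contMDiffAt
          (hφ.mem_nhds hz)).mdifferentiableAt (by simp)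
      have h2 := (hd (φ.symm z)).hasMFDerivAt.comp z h1.hasMFDerivAt
      rw [hm] at h2
      have h3 := h2.hasFDerivAt
      rwa [ContinuousLinearMap.zero_comp] at h3
    obtain ⟨r, hr, hball⟩ := Metric.mem_nhds_iff.1 (extChartAt_target_mem_nhds (I := 𝓘(ℝ, E)) x)
    filter_upwards [(continuousAt_extChartAt (I := 𝓘(ℝ, E)) x).preimage_mem_nhds
      (Metric.ball_mem_nhds _ hr), extChartAt_source_mem_nhds (I := 𝓘(ℝ, E)) x] with y hy hys
    have := (convex_ball (φ x) r).is_const_of_fderivWithin_eq_zero (𝕜 := ℝ)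
      (f := f ∘ φ.symm) (fun z hz => (hD z (hball hz)).differentiableAt.differentiableWithinAt)
      (fun z hz => ((hD z (hball hz)).hasFDerivWithinAt.fderivWithin
        (Metric.isOpen_ball.uniqueDiffWithinAt hz))) hy (Metric.mem_ball_self hr)
    have e : f (φ.symm (φ y)) = f (φ.symm (φ x)) := this
    rwa [φ.left_inv hys, φ.left_inv (mem_extChartAt_source x)] at e
  exact hl.apply_eq_of_isPreconnected isPreconnected_univ (mem_univ _) (mem_univ _)

end Functions

/-! ### Algebra of `J` and of Hermitian metrics -/

section Fields

variable {E : Type*} [NormedAddCommGroup E] [NormedSpace ℂ E]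
  {M : Type*} [TopologicalSpace M] [ChartedSpace E M]

theorem J_J (x : M) (v : TangentSpace 𝓘(ℝ, E) x) : J x (J x v) = -v := by
  have h : ∀ w : E, Complex.I • Complex.I • w = -w := fun w => by simp [smul_smul]
  exact h v

theorem JField_JField (X : VectorFields E M) : JField (JField X) = -X :=
  funext fun x => J_J x (X x)

theorem bracket_self (X : VectorFields E M) : bracket X X = 0 :=
  VectorField.mlieBracket_self

theorem bracket_neg_right [IsManifold 𝓘(ℂ, E) ω M] [CompleteSpace E] (X : VectorFields E M)
    {Y : VectorFields E M} (hY : SmoothField Y) : bracket X (-Y) = -bracket X Y := by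
  have : IsManifold 𝓘(ℝ, E) 2 M := IsManifold.of_le (n := ω) le_top
  funext x
  have h := VectorField.mlieBracket_const_smul_right (V := X) (c := (-1 : ℝ)) (hY.mdifferentiableAt x)
  simpa [bracket] using h

end Fields

section Hermitian

variable {E : Type*} [NormedAddCommGroup E] [NormedSpace ℂ E]
  {M : Type*} [TopologicalSpace M] [ChartedSpace E M] [IsManifold 𝓘(ℂ, E) ω M]

theorem IsHermitian.inner_J_left {g : Metric E M} (hg : IsHermitian g) (x : M)
    (u v : TangentSpace 𝓘(ℝ, E) x) : g.inner x (J x u) v = -g.inner x u (J x v) := by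
  have h := hg x u (J x v)
  rw [J_J, map_neg] at h
  linarith

theorem IsHermitian.inner_J_self {g : Metric E M} (hg : IsHermitian g) (x : M)
    (u : TangentSpace 𝓘(ℝ, E) x) : g.inner x (J x u) u = 0 := by
  have h := hg.inner_J_left x u u
  rw [g.symm x u] at h
  linarith

theorem eq_zero_of_inner_self_eq_zero (g : Metric E M) (x : M)
    {u : TangentSpace 𝓘(ℝ, E) x} (h : g.inner x u u = 0) : u = 0 := by
  by_contra hu
  exact (g.pos x u hu).ne' h

theorem IsKilling.lieD_inner {g : Metric E M} {K : VectorFields E M} (hK : IsKilling g K)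
    {X Y : VectorFields E M} (hX : SmoothField X) (hY : SmoothField Y) (x : M) :
    lieD K (fun y => g.inner y (X y) (Y y)) x
      = g.inner x (bracket K X x) (Y x) + g.inner x (X x) (bracket K Y x) := by
  linarith [hK.lie_metric X Y hX hY x]

end Hermitian

/-! ### Cartan formulas on a normalized Vaisman manifold -/

section Vaisman

variable {E : Type*} [NormedAddCommGroup E] [NormedSpace ℂ E] [FiniteDimensional ℂ E]
  {M : Type*} [TopologicalSpace M] [ChartedSpace E M] [IsManifold 𝓘(ℂ, E) ω M]

theorem LcKStructure.θ_apply (S : LcKStructure E M) (x : M) (v : TangentSpace 𝓘(ℝ, E) x) :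
    S.θ x v = S.g.inner x (S.T x) v :=
  (metricDual_spec S.g S.θ x v).symm

theorem LcKStructure.closed (S : LcKStructure E M) {X Y : VectorFields E M}
    (hX : SmoothField X) (hY : SmoothField Y) (x : M) :
    lieD X (fun y => S.g.inner y (S.T y) (Y y)) x - lieD Y (fun y => S.g.inner y (S.T y) (X y)) x
      = S.g.inner x (S.T x) (bracket X Y x) := by
  have h := S.closed_θ X Y hX hY x
  simp only [dOne, S.θ_apply] at h
  linarith

/-- The exterior derivative of `η = g(JT, ·)`. -/
def LcKStructure.dEta (S : LcKStructure E M) (X Y : VectorFields E M) (x : M) : ℝ :=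
  lieD X (fun y => S.g.inner y (J y (S.T y)) (Y y)) x
    - lieD Y (fun y => S.g.inner y (J y (S.T y)) (X y)) x
    - S.g.inner x (J x (S.T x)) (bracket X Y x)

/-- `dη` is of type `(1,1)`. -/
theorem LcKStructure.dEta_JField (S : LcKStructure E M) {X Y : VectorFields E M}
    (hX : SmoothField X) (hY : SmoothField Y) (x : M) :
    S.dEta (JField X) (JField Y) x = S.dEta X Y x := by
  have : CompleteSpace E := FiniteDimensional.complete ℂ E
  -- Since η ∘ J = θ, closedness of θ on (JX, Y) and (X, JY) turns the derivative terms of dη(JX,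
  -- JY) - dη(X, Y) into θ([JX, Y] + [X, JY]), which the Nijenhuis identity cancels.
  have h1 := S.closed (smoothField_JField hX) hY x
  have h2 := S.closed hX (smoothField_JField hY) x
  have hN := congrArg (fun v => S.g.inner x (S.T x) (J x v)) (nijenhuis_eq_zero hX hY x)
  simp only [map_add, J_J, map_neg] at hN
  simp only [dEta, S.hermitian _, S.hermitian.inner_J_left, JField, lieD_neg]
    at h1 h2 hN ⊢
  linarith

/-- Cartan's formula for L_T Ω, with T⌟Ω = η and T⌟(θ∧Ω) = Ω - θ∧η because θ(T) = 1; as T is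
Killing, only L_T J contributes to L_T Ω. -/
theorem LcKStructure.inner_lie_J (S : LcKStructure E M) (hT : IsKilling S.g S.T)
    (hN : S.IsNormalized) {Y Z : VectorFields E M}
    (hY : SmoothField Y) (hZ : SmoothField Z) (x : M) :
    S.g.inner x (bracket S.T (JField Y) x) (Z x) - S.g.inner x (J x (bracket S.T Y x)) (Z x)
      = S.dEta Y Z x + S.g.inner x (J x (Y x)) (Z x)
        - S.g.inner x (S.T x) (Y x) * S.g.inner x (J x (S.T x)) (Z x)
        + S.g.inner x (S.T x) (Z x) * S.g.inner x (J x (S.T x)) (Y x) := by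
  have h := S.d_fundamentalForm S.T Y Z hT.smooth hY hZ x
  have hK := hT.lieD_inner (smoothField_JField hY) hZ x
  have e : ∀ (x : M) (u v : TangentSpace 𝓘(ℝ, E) x),
    fundamentalForm S.g x u v = S.g.inner x (J x u) v := fun _ _ _ => rfl
  simp only [dTwo, wedgeOneTwo, e, S.θ_apply, hN x] at h
  simp only [dEta]
  simp only [JField] at hK ⊢
  have e1 := S.hermitian.inner_J_left x (bracket S.T Z x) (Y x)
  rw [S.g.symm x (bracket S.T Z x)] at e1
  have e2 := S.hermitian.inner_J_left x (bracket Y Z x) (S.T x)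
  rw [S.g.symm x (bracket Y Z x)] at e2
  have e3 := S.hermitian.inner_J_left x (Z x) (S.T x)
  rw [S.g.symm x (Z x)] at e3
  rw [e1, e2, e3, hK] at h
  linarith

/-- The Lee vector field of a normalized Vaisman structure is holomorphic. -/
theorem LcKStructure.bracket_T_JField [T2Space M] (S : LcKStructure E M)
    (hT : IsKilling S.g S.T) (hN : S.IsNormalized) {Y : VectorFields E M} (hY : SmoothField Y)
    (x : M) : bracket S.T (JField Y) x = J x (bracket S.T Y x) := by
  have : CompleteSpace E := FiniteDimensional.complete ℂ E
  -- `Z` extends the vector (L_T J)Y itself. Replacing (Y, Z) by (JY, JZ) fixes the right side of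
  -- `inner_lie_J` and negates the left, since L_T J anticommutes with J; hence this vector has norm
  -- zero.
  obtain ⟨Z, hZ, hZx⟩ := exists_smoothField_apply_eq x
    (bracket S.T (JField Y) x - J x (bracket S.T Y x))
  have h1 := S.inner_lie_J hT hN hY hZ x
  have h2 := S.inner_lie_J hT hN (smoothField_JField hY) (smoothField_JField hZ) x
  rw [S.dEta_JField hY hZ, JField_JField, bracket_neg_right _ hY] at h2
  simp only [JField, J_J, S.hermitian _, S.hermitian.inner_J_left, map_neg, Pi.neg_apply,
    neg_apply] at h1 h2
  refine sub_eq_zero.1 (eq_zero_of_inner_self_eq_zero S.g x ?_)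
  rw [← hZx]
  nth_rw 1 [hZx]
  simp only [map_sub, sub_apply, S.hermitian.inner_J_left]
  linarith

theorem LcKStructure.dEta_eq [T2Space M] (S : LcKStructure E M)
    (hT : IsKilling S.g S.T) (hN : S.IsNormalized) {Y Z : VectorFields E M}
    (hY : SmoothField Y) (hZ : SmoothField Z) (x : M) :
    S.dEta Y Z x = S.g.inner x (S.T x) (Y x) * S.g.inner x (J x (S.T x)) (Z x)
        - S.g.inner x (S.T x) (Z x) * S.g.inner x (J x (S.T x)) (Y x)
        - S.g.inner x (J x (Y x)) (Z x) := by
  have h := S.inner_lie_J hT hN hY hZ x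
  rw [S.bracket_T_JField hT hN hY] at h
  linarith

/-- Both sides are (L_K θ)(Y): the left because K preserves g, the right by Cartan's formula and dθ
= 0. -/
theorem LcKStructure.inner_bracket_T (S : LcKStructure E M) (hT : IsKilling S.g S.T)
    {K Y : VectorFields E M} (hK : IsKilling S.g K) (hY : SmoothField Y) (x : M) :
    S.g.inner x (bracket K S.T x) (Y x) = lieD Y (fun y => S.g.inner y (S.T y) (K y)) x := by
  have h1 := hK.lieD_inner hT.smooth hY x
  have h2 := S.closed hK.smooth hY x
  linarith

/-- This is d(η(K)) = L_K η - K⌟dη, where L_K η = g(J[K, T], ·) and dη = θ∧η - Ω. -/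
theorem LcKStructure.lieD_hamiltonian [T2Space M] (S : LcKStructure E M)
    (hT : IsKilling S.g S.T) (hN : S.IsNormalized) {K Y : VectorFields E M}
    (hhol : IsHolomorphicField K) (hK : IsKilling S.g K) (hY : SmoothField Y) (x : M) :
    lieD Y (fun y => S.g.inner y (J y (S.T y)) (K y)) x
      = S.g.inner x (J x (bracket K S.T x)) (Y x) + S.g.inner x (J x (K x)) (Y x)
        - S.g.inner x (S.T x) (K x) * S.g.inner x (J x (S.T x)) (Y x)
        + S.g.inner x (S.T x) (Y x) * S.g.inner x (J x (S.T x)) (K x) := by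
  have h1 := hK.lieD_inner (smoothField_JField hT.smooth) hY x
  have h2 := S.dEta_eq hT hN hK.smooth hY x
  rw [hhol.lie_complex _ hT.smooth x] at h1
  simp only [dEta] at h2
  simp only [JField] at h1
  linarith

end Vaisman

/-! ### Invariance of Ω and dΩ under holomorphic Killing fields -/

section FundamentalForm

variable {E : Type*} [NormedAddCommGroup E] [NormedSpace ℂ E]
  {M : Type*} [TopologicalSpace M] [ChartedSpace E M] [IsManifold 𝓘(ℂ, E) ω M]

theorem lieD_fundamentalForm {g : Metric E M} {K X Y : VectorFields E M}
    (hhol : IsHolomorphicField K) (hK : IsKilling g K) (hX : SmoothField X) (hY : SmoothField Y)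
    (x : M) :
    lieD K (fun y => fundamentalForm g y (X y) (Y y)) x
      = fundamentalForm g x (bracket K X x) (Y x) + fundamentalForm g x (X x) (bracket K Y x) := by
  have h := hK.lieD_inner (smoothField_JField hX) hY x
  rw [hhol.lie_complex X hX x] at h
  exact h

theorem smooth_fundamentalForm (g : Metric E M) {X Y : VectorFields E M}
    (hX : SmoothField X) (hY : SmoothField Y) :
    ContMDiff 𝓘(ℝ, E) 𝓘(ℝ, ℝ) ∞ (fun y => fundamentalForm g y (X y) (Y y)) :=
  smooth_metric_apply g (smoothField_JField hX) hY

/-- The exterior derivative of the fundamental form is preserved by a holomorphic Killing field. -/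
theorem lieD_dTwo [CompleteSpace E] {g : Metric E M} {K X Y Z W : VectorFields E M}
    (hhol : IsHolomorphicField K) (hK : IsKilling g K)
    (hX : SmoothField X) (hY : SmoothField Y) (hZ : SmoothField Z) (hW : SmoothField W)
    (hWx : ∀ x, W x ≠ 0) (x : M) :
    lieD K (dTwo (fundamentalForm g) X Y Z) x = dTwo (fundamentalForm g) (bracket K X) Y Z x
      + dTwo (fundamentalForm g) X (bracket K Y) Z x
      + dTwo (fundamentalForm g) X Y (bracket K Z) x := by
  set w := fundamentalForm g
  have hk := hK.smooth
  have sm : ∀ {A B : VectorFields E M}, SmoothField A → SmoothField B →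
      ContMDiff 𝓘(ℝ, E) 𝓘(ℝ, ℝ) ∞ (fun y => w y (A y) (B y)) := smooth_fundamentalForm g
  have inv : ∀ {A B : VectorFields E M}, SmoothField A → SmoothField B → ∀ x,
      lieD K (fun y => w y (A y) (B y)) x = w x (bracket K A x) (B x) + w x (A x) (bracket K B x) :=
    lieD_fundamentalForm hhol hK
  have br : ∀ {A B : VectorFields E M}, SmoothField A → SmoothField B →
      SmoothField (bracket A B) := smoothField_bracket
  -- Moving `K` past `A` costs [K, A]; the nowhere zero field `W` serves only to apply
  -- `lieD_bracket` here.
  have first : ∀ {A B C : VectorFields E M}, SmoothField A → SmoothField B → SmoothField C →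
      lieD K (lieD A (fun y => w y (B y) (C y))) x
        = lieD A (fun y => w y (bracket K B y) (C y)) x
          + lieD A (fun y => w y (B y) (bracket K C y)) x
          + lieD (bracket K A) (fun y => w y (B y) (C y)) x := by
    intro A B C hA hB hC
    have h := lieD_bracket hk hA hW (sm hB hC) (hWx x)
    rw [funext (inv hB hC), lieD_add (sm (br hk hB) hC) (sm hB (br hk hC))] at h
    linarith
  have second : ∀ {A B C : VectorFields E M}, SmoothField A → SmoothField B → SmoothField C →
      lieD K (fun y => w y (bracket A B y) (C y)) x
        = w x (bracket (bracket K A) B x) (C x) + w x (bracket A (bracket K B) x) (C x)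
          + w x (bracket A B x) (bracket K C x) := by
    intro A B C hA hB hC
    rw [inv (br hA hB) hC, bracket_bracket hk hA hB]
    simp only [Pi.add_apply, map_add, add_apply]
  have lsm : ∀ {A B C : VectorFields E M}, SmoothField A → SmoothField B → SmoothField C →
      ContMDiff 𝓘(ℝ, E) 𝓘(ℝ, ℝ) ∞ (lieD A (fun y => w y (B y) (C y))) :=
    fun hA hB hC => smooth_lieD (sm hB hC) hA
  have s1 := lsm hX hY hZ
  have s2 := lsm hY hX hZ
  have s3 := lsm hZ hX hY
  have s4 := sm (br hX hY) hZ
  have s5 := sm (br hX hZ) hY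
  have s6 := sm (br hY hZ) hX
  have e : dTwo w X Y Z = fun y => lieD X (fun y => w y (Y y) (Z y)) y
    - lieD Y (fun y => w y (X y) (Z y)) y
    + lieD Z (fun y => w y (X y) (Y y)) y
    - w y (bracket X Y y) (Z y) + w y (bracket X Z y) (Y y) - w y (bracket Y Z y) (X y) := rfl
  have t2 := smooth_sub s1 s2
  have t3 := smooth_add t2 s3
  have t4 := smooth_sub t3 s4
  have t5 := smooth_add t4 s5
  rw [e, lieD_sub t5 s6, lieD_add t4 s5, lieD_sub t3 s4, lieD_add t2 s3, lieD_sub s1 s2,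
    first hX hY hZ, first hY hX hZ, first hZ hX hY,
    second hX hY hZ, second hX hZ hY, second hY hZ hX]
  simp only [dTwo]
  ring

end FundamentalForm

/-! ### Constancy of θ(K) -/

section Constancy

variable {E : Type*} [NormedAddCommGroup E] [NormedSpace ℂ E] [FiniteDimensional ℂ E]
  {M : Type*} [TopologicalSpace M] [ChartedSpace E M] [IsManifold 𝓘(ℂ, E) ω M]

variable (S : LcKStructure E M)

theorem LcKStructure.smooth_inner_T {S : LcKStructure E M} (hT : IsKilling S.g S.T)
    {X : VectorFields E M} (hX : SmoothField X) :
    ContMDiff 𝓘(ℝ, E) 𝓘(ℝ, ℝ) ∞ (fun y => S.g.inner y (S.T y) (X y)) :=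
  smooth_metric_apply S.g hT.smooth hX

theorem LcKStructure.T_ne_zero {S : LcKStructure E M} (hN : S.IsNormalized) (x : M) :
    S.T x ≠ 0 := by
  intro h
  have := hN x
  rw [h, map_zero] at this
  simp at this

/-- This is d(θ(K))∧Ω = 0: K preserves Ω and dΩ = θ∧Ω, so L_K θ∧Ω = 0, and L_K θ = d(θ(K)). -/
theorem LcKStructure.lieD_wedge (hT : IsKilling S.g S.T) (hN : S.IsNormalized)
    {K X Y Z : VectorFields E M} (hhol : IsHolomorphicField K) (hK : IsKilling S.g K)
    (hX : SmoothField X) (hY : SmoothField Y) (hZ : SmoothField Z) (x : M) :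
    lieD X (fun y => S.g.inner y (S.T y) (K y)) x * fundamentalForm S.g x (Y x) (Z x)
      + lieD Y (fun y => S.g.inner y (S.T y) (K y)) x * fundamentalForm S.g x (Z x) (X x)
      + lieD Z (fun y => S.g.inner y (S.T y) (K y)) x * fundamentalForm S.g x (X x) (Y x)
        = 0 := by
  have : CompleteSpace E := FiniteDimensional.complete ℂ E
  have h := lieD_dTwo hhol hK hX hY hZ hT.smooth (LcKStructure.T_ne_zero hN) x
  have hk := hK.smooth
  rw [funext (S.d_fundamentalForm X Y Z hX hY hZ),
    S.d_fundamentalForm _ _ _ (smoothField_bracket hk hX) hY hZ,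
    S.d_fundamentalForm _ _ _ hX (smoothField_bracket hk hY) hZ,
    S.d_fundamentalForm _ _ _ hX hY (smoothField_bracket hk hZ)] at h
  simp only [wedgeOneTwo, S.θ_apply] at h
  have θX := LcKStructure.smooth_inner_T hT hX
  have θY := LcKStructure.smooth_inner_T hT hY
  have θZ := LcKStructure.smooth_inner_T hT hZ
  have wX := smooth_fundamentalForm S.g hY hZ
  have wY := smooth_fundamentalForm S.g hZ hX
  have wZ := smooth_fundamentalForm S.g hX hY
  have tX := smooth_mul θX wX
  have tY := smooth_mul θY wY
  have tZ := smooth_mul θZ wZ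
  rw [lieD_add (smooth_add tX tY) tZ, lieD_add tX tY,
    lieD_mul θX wX, lieD_mul θY wY, lieD_mul θZ wZ, lieD_fundamentalForm hhol hK hY hZ,
    lieD_fundamentalForm hhol hK hZ hX, lieD_fundamentalForm hhol hK hX hY] at h
  have cX := S.closed hk hX x
  have cY := S.closed hk hY x
  have cZ := S.closed hk hZ x
  rw [← cX, ← cY, ← cZ] at h
  linear_combination h

/-- In complex dimension at least `2`, for every vector `u` there is a non-zero vector
orthogonal to `u` and `Ju`. -/
theorem exists_orthogonal (hE : 2 ≤ Module.finrank ℂ E) (g : Metric E M) (x : M)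
    (u : TangentSpace 𝓘(ℝ, E) x) :
    ∃ v : TangentSpace 𝓘(ℝ, E) x, v ≠ 0 ∧ g.inner x u v = 0 ∧ g.inner x (J x u) v = 0 := by
  have : FiniteDimensional ℝ E := FiniteDimensional.complexToReal E
  let L : E →ₗ[ℝ] ℝ × ℝ :=
    LinearMap.prod (g.inner x u : E →L[ℝ] ℝ).toLinearMap
      (g.inner x (J x u) : E →L[ℝ] ℝ).toLinearMap
  have hr : Module.finrank ℝ (ℝ × ℝ) < Module.finrank ℝ E := by
    rw [← Module.finrank_mul_finrank ℝ ℂ E, Complex.finrank_real_complex, Module.finrank_prod,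
      Module.finrank_self]
    omega
  obtain ⟨v, hv, hv0⟩ := (Submodule.ne_bot_iff _).1 (LinearMap.ker_ne_bot_of_finrank_lt hr (f := L))
  have h : L v = 0 := hv
  exact ⟨v, hv0, congrArg Prod.fst h, congrArg Prod.snd h⟩

theorem LcKStructure.mvfderiv_lee_eq_zero_of_two_le [T2Space M] (hE : 2 ≤ Module.finrank ℂ E)
    (hT : IsKilling S.g S.T) (hN : S.IsNormalized)
    {K : VectorFields E M} (hhol : IsHolomorphicField K) (hK : IsKilling S.g K) (x : M) :
    mvfderiv 𝓘(ℝ, E) (fun y => S.g.inner y (S.T y) (K y)) x = 0 := by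
  ext u
  obtain ⟨v, hv0, hv1, hv2⟩ := exists_orthogonal hE S.g x u
  obtain ⟨X, hX, rfl⟩ := exists_smoothField_apply_eq x u
  obtain ⟨Y, hY, rfl⟩ := exists_smoothField_apply_eq x v
  -- On (u, v, Jv) with v orthogonal to u and Ju, only the term df(u)·g(v, v) survives.
  have h := S.lieD_wedge hT hN hhol hK hX hY (smoothField_JField hY) x
  have e : ∀ (x : M) (u v : TangentSpace 𝓘(ℝ, E) x),
    fundamentalForm S.g x u v = S.g.inner x (J x u) v := fun _ _ _ => rfl
  simp only [e, JField, S.hermitian _, J_J, map_neg, neg_apply, hv2, S.g.symm x (Y x) (X x), hv1,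
    neg_zero, mul_zero, add_zero] at h
  exact (mul_eq_zero.1 h).resolve_right (S.g.pos x _ hv0).ne'

/-- The nonvanishing of T forces complex dimension 1, so v is a complex multiple of T; its real and
imaginary parts are the two inner products. -/
theorem LcKStructure.eq_T_add_JT (hE : Module.finrank ℂ E < 2) (hN : S.IsNormalized) (x : M)
    (v : TangentSpace 𝓘(ℝ, E) x) :
    v = S.g.inner x (S.T x) v • S.T x + S.g.inner x (J x (S.T x)) v • J x (S.T x) := by
  obtain ⟨t, ht⟩ : ∃ t : E, t = S.T x := ⟨_, rfl⟩
  obtain ⟨z, hz⟩ : ∃ z : ℂ, z • t = v := by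
    have h1 : Module.finrank ℂ E = 1 := by
      have : Nontrivial E := ⟨⟨S.T x, 0, LcKStructure.T_ne_zero hN x⟩⟩
      have := Module.finrank_pos (R := ℂ) (M := E)
      omega
    exact exists_smul_eq_of_finrank_eq_one h1 (ht ▸ LcKStructure.T_ne_zero hN x) v
  have hv : v = z.re • S.T x + z.im • J x (S.T x) := by
    rw [← hz]
    have : ∀ t : E, z • t = z.re • t + z.im • (Complex.I • t) := by
      intro t
      conv_lhs => rw [← Complex.re_add_im z, add_smul, mul_smul]
      simp only [Complex.coe_smul]
    rw [this, ht]
    rfl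
  have h1 : S.g.inner x (S.T x) v = z.re := by
    rw [hv, map_add, map_smul, map_smul, hN x, S.g.symm x (S.T x), S.hermitian.inner_J_self]
    simp
  have h2 : S.g.inner x (J x (S.T x)) v = z.im := by
    rw [hv, map_add, map_smul, map_smul, S.hermitian x, hN x, S.hermitian.inner_J_self]
    simp
  rw [h1, h2]
  exact hv

theorem LcKStructure.mvfderiv_eq_zero (hE : Module.finrank ℂ E < 2) (hN : S.IsNormalized)
    {f : M → ℝ} {x : M} (h1 : lieD S.T f x = 0) (h2 : lieD (JField S.T) f x = 0) :
    mvfderiv 𝓘(ℝ, E) f x = 0 := by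
  ext v
  have e1 : mvfderiv 𝓘(ℝ, E) f x (S.T x) = 0 := h1
  have e2 : mvfderiv 𝓘(ℝ, E) f x (J x (S.T x)) = 0 := h2
  rw [S.eq_T_add_JT hE hN x v, map_add, map_smul, map_smul, e1, e2]
  simp

theorem LcKStructure.mvfderiv_lee_eq_zero_of_compact [T2Space M] [CompactSpace M]
    [ConnectedSpace M] (hE : Module.finrank ℂ E < 2)
    (hT : IsKilling S.g S.T) (hN : S.IsNormalized)
    {K : VectorFields E M} (hhol : IsHolomorphicField K) (hK : IsKilling S.g K) (x : M) :
    mvfderiv 𝓘(ℝ, E) (fun y => S.g.inner y (S.T y) (K y)) x = 0 := by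
  have : CompleteSpace E := FiniteDimensional.complete ℂ E
  have : IsManifold 𝓘(ℝ, E) 1 M := IsManifold.of_le (n := ω) le_top
  set f : M → ℝ := fun y => S.g.inner y (S.T y) (K y) with hf
  set h : M → ℝ := fun y => S.g.inner y (J y (S.T y)) (K y) with hh
  have hJT : SmoothField (JField S.T) := smoothField_JField hT.smooth
  have sf : ContMDiff 𝓘(ℝ, E) 𝓘(ℝ, ℝ) ∞ f := smooth_metric_apply S.g hT.smooth hK.smooth
  have sh : ContMDiff 𝓘(ℝ, E) 𝓘(ℝ, ℝ) ∞ h := smooth_metric_apply S.g hJT hK.smooth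
  -- In dimension 1, Ω = θ∧η, so dη = 0 and `lieD_hamiltonian` reduces to dh = g(J[K, T], ·).
  have CR : ∀ {Y : VectorFields E M}, SmoothField Y → ∀ x, lieD Y h x = -lieD (JField Y) f x := by
    intro Y hY x
    rw [hh, S.lieD_hamiltonian hT hN hhol hK hY x, hf,
      ← S.inner_bracket_T hT hK (smoothField_JField hY), S.hermitian.inner_J_left]
    have hKx := congrArg (fun v => S.g.inner x (J x v) (Y x)) (S.eq_T_add_JT hE hN x (K x))
    simp only [map_add, map_smul, J_J, add_apply, smul_apply, neg_apply, map_neg, smul_eq_mul]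
      at hKx
    rw [hKx]
    simp only [JField]
    ring
  -- T(f) = g([K, T], T) is half the derivative along K of the constant |T|².
  have Tf : ∀ x, lieD S.T f x = 0 := by
    intro x
    rw [hf, ← S.inner_bracket_T hT hK hT.smooth]
    have h1 := hK.lieD_inner hT.smooth hT.smooth x
    rw [funext hN, lieD_const, S.g.symm x (S.T x)] at h1
    linarith
  have JTh : ∀ x, lieD (JField S.T) h x = 0 := by
    intro x
    rw [CR hJT, JField_JField]
    have e : lieD (-S.T) f x = -lieD S.T f x := map_neg _ _
    rw [e, Tf, neg_zero, neg_zero]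
  have Th : lieD S.T h = fun x => -lieD (JField S.T) f x := funext (CR hT.smooth)
  have comm : bracket S.T (JField S.T) = 0 := by
    funext x
    rw [S.bracket_T_JField hT hN hT.smooth, bracket_self]
    exact map_zero _
  have comm' : ∀ {u : M → ℝ}, ContMDiff 𝓘(ℝ, E) 𝓘(ℝ, ℝ) ∞ u → ∀ x,
      lieD S.T (lieD (JField S.T) u) x = lieD (JField S.T) (lieD S.T u) x := by
    intro u hu x
    have h1 := lieD_bracket hT.smooth hJT hT.smooth hu (LcKStructure.T_ne_zero hN x)
    have h0 : lieD (bracket S.T (JField S.T)) u x = 0 := by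
      rw [comm]
      exact map_zero _
    linarith
  have sp := smooth_lieD sf hJT
  -- T and JT commute, so T(JT(f)) = JT(T(f)) = 0 and JT(JT(f)) = -JT(T(h)) = -T(JT(h)) = 0.
  have hp : ∀ x, mvfderiv 𝓘(ℝ, E) (lieD (JField S.T) f) x = 0 := by
    intro x
    refine S.mvfderiv_eq_zero hE hN ?_ ?_
    · rw [comm' sf, funext Tf, lieD_const]
    · have h1 := comm' sh x
      rw [funext JTh, lieD_const, Th, lieD_neg] at h1
      linarith
  obtain ⟨x₀, -, hx₀⟩ := isCompact_univ.exists_isMaxOn (univ_nonempty (α := M))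
    sf.continuous.continuousOn
  have h0 := mvfderiv_eq_zero_of_isMaxOn ((sf x₀).mdifferentiableAt (by simp)) hx₀
  refine S.mvfderiv_eq_zero hE hN (Tf x) ?_
  rw [eq_const_of_mvfderiv_eq_zero sp hp x x₀, lieD, h0]
  rfl

end Constancy

end

end LcK

/-! ### The decomposition of K -/

theorem lemma4p4 {E : Type*} [NormedAddCommGroup E] [NormedSpace ℂ E] [FiniteDimensional ℂ E]
    {M : Type*} [TopologicalSpace M] [T2Space M] [ConnectedSpace M] [ChartedSpace E M]
    [IsManifold 𝓘(ℂ, E) ω M]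
    (hM : 2 ≤ Module.finrank ℂ E ∨ CompactSpace M)
    (S : LcK.LcKStructure E M) (hV : S.IsVaisman) (hN : S.IsNormalized)
    (K : LcK.VectorFields E M) (hhol : LcK.IsHolomorphicField K) (hkill : LcK.IsKilling S.g K) :
    ∃ (c : ℝ) (a : M → ℝ) (K₀ : LcK.VectorFields E M),
      ContMDiff 𝓘(ℝ, E) 𝓘(ℝ, ℝ) ∞ a ∧ LcK.SmoothField K₀ ∧
      (∀ x, K x = c • S.T x + a x • LcK.JField S.T x + K₀ x) ∧
      (∀ x, S.g.inner x (K₀ x) (S.T x) = 0 ∧ S.g.inner x (K₀ x) (LcK.JField S.T x) = 0) ∧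
      (∀ (x : M) (v : TangentSpace 𝓘(ℝ, E) x), S.Ω x (K₀ x) v = mvfderiv 𝓘(ℝ, E) a x v) ∧
      (∀ x, LcK.lieD S.T a x = 0 ∧ LcK.lieD (LcK.JField S.T) a x = 0) := by
  have hT := hV.1
  have : IsManifold 𝓘(ℝ, E) 1 M := IsManifold.of_le (n := ω) le_top
  have hdf : ∀ x, mvfderiv 𝓘(ℝ, E) (fun y => S.g.inner y (S.T y) (K y)) x = 0 := by
    intro x
    by_cases hE : 2 ≤ Module.finrank ℂ E
    · exact S.mvfderiv_lee_eq_zero_of_two_le hE hT hN hhol hkill x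
    · have := hM.resolve_left hE
      exact S.mvfderiv_lee_eq_zero_of_compact (not_le.1 hE) hT hN hhol hkill x
  have hJT := LcK.smoothField_JField hT.smooth
  obtain ⟨c, hc⟩ : ∃ c : ℝ, ∀ x, S.g.inner x (S.T x) (K x) = c :=
    ⟨_, fun x => LcK.eq_const_of_mvfderiv_eq_zero
      (LcK.smooth_metric_apply S.g hT.smooth hkill.smooth) hdf x (Classical.arbitrary M)⟩
  set a : M → ℝ := fun y => S.g.inner y (LcK.J y (S.T y)) (K y) with ha
  have sa : ContMDiff 𝓘(ℝ, E) 𝓘(ℝ, ℝ) ∞ a := LcK.smooth_metric_apply S.g hJT hkill.smooth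
  have hJJ : ∀ x, S.g.inner x (LcK.J x (S.T x)) (LcK.J x (S.T x)) = 1 := fun x => by
    rw [S.hermitian x, hN x]
  have hTJ : ∀ x, S.g.inner x (LcK.J x (S.T x)) (S.T x) = 0 := fun x =>
    S.hermitian.inner_J_self x _
  have hTJ' : ∀ x, S.g.inner x (S.T x) (LcK.J x (S.T x)) = 0 := fun x => by
    rw [S.g.symm, hTJ]
  have hKT : ∀ x, S.g.inner x (K x) (S.T x) = c := fun x => by rw [S.g.symm, hc]
  have hKJ : ∀ x, S.g.inner x (K x) (LcK.J x (S.T x)) = a x := fun x => by rw [S.g.symm]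
  -- [K, T] is the gradient of the constant θ(K).
  have hbr : ∀ x, LcK.bracket K S.T x = 0 := by
    intro x
    obtain ⟨Y, hY, hYx⟩ := LcK.exists_smoothField_apply_eq x (LcK.bracket K S.T x)
    refine LcK.eq_zero_of_inner_self_eq_zero S.g x ?_
    have h := S.inner_bracket_T hT hkill hY x
    rw [hYx, LcK.lieD, hdf] at h
    exact h
  set K₀ : LcK.VectorFields E M :=
    K + ((fun _ : M => -c) • S.T + (fun x : M => -a x) • LcK.JField S.T) with hK₀
  have hK₀x : ∀ x, K₀ x = K x + (-c • S.T x + -a x • LcK.J x (S.T x)) := fun x => rfl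
  have orth : ∀ x, S.g.inner x (K₀ x) (S.T x) = 0 ∧
      S.g.inner x (K₀ x) (LcK.JField S.T x) = 0 := by
    intro x
    simp only [hK₀x, LcK.JField, map_add, map_smul, add_apply, smul_apply, hKT, hKJ, hTJ, hTJ',
      hJJ, hN x, smul_eq_mul]
    constructor <;> ring
  have hΩ : ∀ (x : M) (v : TangentSpace 𝓘(ℝ, E) x),
      S.Ω x (K₀ x) v = mvfderiv 𝓘(ℝ, E) a x v := by
    intro x v
    obtain ⟨Y, hY, rfl⟩ := LcK.exists_smoothField_apply_eq x v
    have h := S.lieD_hamiltonian hT hN hhol hkill hY x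
    rw [hbr, hc] at h
    change S.g.inner x (LcK.J x (K₀ x)) (Y x) = LcK.lieD Y a x
    rw [ha, h]
    simp only [hK₀x, map_add, map_smul, add_apply, smul_apply, LcK.J_J, map_neg, neg_apply,
      map_zero, zero_apply, smul_eq_mul]
    ring
  refine ⟨c, a, K₀, sa, ?_, ?_, orth, hΩ, fun x => ⟨?_, ?_⟩⟩
  · exact LcK.smoothField_add hkill.smooth (LcK.smoothField_add
      (LcK.smoothField_smul contMDiff_const hT.smooth) (LcK.smoothField_smul sa.neg hJT))
  · intro x
    rw [hK₀x]
    simp only [LcK.JField, neg_smul]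
    abel
  -- T(a) = Ω(K₀, T) = -g(K₀, JT), and below JT(a) = Ω(K₀, JT) = g(K₀, T).
  · refine (hΩ x (S.T x)).symm.trans ?_
    change S.g.inner x (LcK.J x (K₀ x)) (S.T x) = 0
    rw [S.hermitian.inner_J_left]
    exact neg_eq_zero.2 (orth x).2
  · refine (hΩ x (LcK.JField S.T x)).symm.trans ?_
    change S.g.inner x (LcK.J x (K₀ x)) (LcK.J x (S.T x)) = 0
    rw [S.hermitian x]
    exact (orth x).1
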